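/- For an integer $k$ let $a_{2k}=\zeta(1-2k)$ if $k\neq 0$ and $a_0=2\zeta'(0)=-\log 2\pi$, where $\zeta$ is the Riemann zeta-function, and for $z$ in the upper half-plane ($\operatorname{Im} z>0$) define, with $q=e^{2\pi i z}$, $$E_{2k}(z)=1+\frac{2}{a_{2k}}\sum_{l=1}^{\infty}\frac{l^{2k-1}q^l}{1-q^l}.$$ Let $B_n$ denote the Bernoulli numbers, $\delta_{k0}$ Kronecker's symbol, and take the branch of $\log z$ with $0<\arg z<\pi$. Then for every integer $k$ and every $z$ with $\operatorname{Im} z>0$, $$E_{2k}\Bigl(-\frac1z\Bigr)=z^{2k}\biggl\{E_{2k}(z)+\frac{(-2\pi i)^{1-2k}}{a_{2k}}\biggl[\Bigl(\frac{\log z}{2\pi i}-\frac14\Bigr)\delta_{k0}+\sum_{j=0}^{1-k}\frac{B_{2j}B_{2-2k-2j}}{(2j)!\,(2-2k-2j)!}z^{1-2k-2j}\biggr]\biggr\},$$ where the sum is empty if $k\geq 2$. In particular, $$E_0\Bigl(-\frac1z\Bigr)=E_0(z)+\frac{1}{\log 2\pi}\Bigl(\log z-\frac{\pi i}{2}+\frac{\pi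 i z}{6}+\frac{\pi i}{6z}\Bigr),$$ $$E_2\Bigl(-\frac1z\Bigr)=z^2E_2(z)+\frac{6z}{\pi i}.$$ -/

import Mathlib

/-- The normalizing constant `a_{2k}`: `ζ(1 - 2k)` for `k ≠ 0`, and `2 ζ'(0)` for `k = 0`. -/
noncomputable def eisensteinConst (k : ℤ) : ℂ :=
  if k = 0 then 2 * deriv riemannZeta 0 else riemannZeta (1 - 2 * k)

/-- `2 ζ'(0) = -log 2π`. -/
theorem eisensteinConst_zero : eisensteinConst 0 = -(Real.log (2 * Real.pi) : ℂ) := by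
  have h : (2 * Real.pi : ℂ) = ((2 * Real.pi : ℝ) : ℂ) := by push_cast; rfl
  rw [eisensteinConst, if_pos rfl, deriv_riemannZeta_zero, h,
    ← Complex.ofReal_log (by positivity)]
  ring

/-- The term `l^{2k-1} q^l / (1 - q^l)`, where `q = e^{2πiz}`. -/
noncomputable def eisensteinTerm (k : ℤ) (z : ℂ) (l : ℕ+) : ℂ :=
  (l : ℂ) ^ (2 * k - 1) * Complex.exp (2 * Real.pi * Complex.I * z) ^ (l : ℕ) /
    (1 - Complex.exp (2 * Real.pi * Complex.I * z) ^ (l : ℕ))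

/-- The classical Eisenstein series `E_{2k}(z)` of weight `2k`, for any integer `k`
and `z` in the upper half-plane. -/
noncomputable def eisensteinE (k : ℤ) (z : ℂ) : ℂ :=
  1 + 2 / eisensteinConst k * ∑' l : ℕ+, eisensteinTerm k z l

/-- The series defining `E_{2k}(z)` converges absolutely in the upper half-plane. -/
theorem summable_eisensteinTerm (k : ℤ) {z : ℂ} (hz : 0 < z.im) :
    Summable (eisensteinTerm k z) := by
  obtain ⟨q, hq⟩ : ∃ q, q = Complex.exp (2 * Real.pi * Complex.I * z) := ⟨_, rfl⟩
  have hq1 : ‖q‖ < 1 := by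
    rw [hq, Complex.norm_exp, Real.exp_lt_one_iff]
    have : (2 * Real.pi * Complex.I * z).re = -(2 * Real.pi * z.im) := by
      simp [Complex.mul_re, Complex.mul_im]
    rw [this]
    have := Real.pi_pos
    simp only [Left.neg_neg_iff]
    positivity
  obtain ⟨m, hm⟩ : ∃ m : ℕ, 2 * k - 1 ≤ (m : ℤ) :=
    ⟨(2 * k - 1).toNat, Int.self_le_toNat _⟩
  have hq2 : ‖‖q‖‖ < 1 := by rwa [norm_norm]
  have hs0 : Summable fun n : ℕ => (n : ℝ) ^ m * ‖q‖ ^ n :=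
    summable_pow_mul_geometric_of_norm_lt_one m hq2
  have hs : Summable fun n : ℕ => (n : ℝ) ^ m * ‖q‖ ^ n * (1 - ‖q‖)⁻¹ :=
    hs0.mul_right _
  have hs' : Summable fun l : ℕ+ => ((l : ℕ) : ℝ) ^ m * ‖q‖ ^ (l : ℕ) * (1 - ‖q‖)⁻¹ :=
    hs.comp_injective PNat.coe_injective
  refine Summable.of_norm_bounded hs' fun l => ?_
  have hl : (1 : ℝ) ≤ (l : ℕ) := by exact_mod_cast l.2
  have hd : 1 - ‖q‖ ≤ ‖1 - q ^ (l : ℕ)‖ := by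
    have h1 := norm_sub_norm_le (1 : ℂ) (q ^ (l : ℕ))
    rw [norm_one, norm_pow] at h1
    have h2 : ‖q‖ ^ (l : ℕ) ≤ ‖q‖ := pow_le_of_le_one (norm_nonneg _) hq1.le l.ne_zero
    linarith
  have hp : ((l : ℕ) : ℝ) ^ (2 * k - 1) ≤ ((l : ℕ) : ℝ) ^ m := by
    rw [← zpow_natCast]
    exact zpow_le_zpow_right₀ hl hm
  have hpos : 0 < 1 - ‖q‖ := by linarith
  simp only [eisensteinTerm, ← hq]
  rw [norm_div, norm_mul, norm_zpow, norm_pow, div_eq_mul_inv]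
  have hn : ‖((l : ℕ) : ℂ)‖ = ((l : ℕ) : ℝ) := by simp
  rw [hn]
  gcongr

/-! The mechanism depends on the sign of `k`. For `k ≥ 2`, `E_{2k}` is the normalized level-one
Eisenstein series, and the correction is empty. For `k = 1` the law is the quasi-modularity of `E2`.

For `k = 0`, the Lambert series has derivative `2πi` times the weight-2 series
(`hasDerivAt_tsum_eisensteinTerm_zero`). The weight-2 law therefore integrates to the weight-0 law
up to a constant, which the fixed point `i` of `z ↦ -1/z` determines.

For `k = -p < 0`, the cotangent expansion turns `ζ(2p+1) E_{-2p}(z)` into a multiple of `ζ(2p+2)/z`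
plus a double series over `1 / (l^{2p} (l²z² - m²))` (`eisensteinE_neg_eq_tsum`). The inversion
swaps `l` and `m`. Partial fractions trade `l^{2p}` for `m^{2p}` at the cost of products of even
zeta values (`tsum_reciprocityKernel_neg_one_div`), which Euler's formula turns into Bernoulli
numbers. -/

/-- The matrix `S` preserves the upper half-plane. -/
theorem im_neg_one_div_pos {z : ℂ} (hz : 0 < z.im) : 0 < (-1 / z).im := by
  have h := UpperHalfPlane.im_inv_neg_coe_pos ⟨z, hz⟩
  have e : -1 / z = (-z)⁻¹ := by rw [inv_neg, neg_div, one_div]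
  rw [e]
  exact h

/-! ### Positive weight -/

/-- The transformation law in weight at least `4`. -/
theorem eisensteinE_neg_one_div_of_two_le {k : ℤ} (hk : 2 ≤ k) {z : ℂ} (hz : 0 < z.im) :
    eisensteinE k (-1 / z) = z ^ (2 * k) * eisensteinE k z := by
  obtain ⟨m, rfl⟩ : ∃ m : ℕ, k = m := ⟨k.toNat, by omega⟩
  have hm : 3 ≤ 2 * m := by omega
  have key : ∀ τ : UpperHalfPlane, eisensteinE m τ = ModularForm.E hm τ := by
    intro τ
    rw [EisensteinSeries.q_expansion_bernoulli hm (even_two_mul m) τ, eisensteinE]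
    have hq := UpperHalfPlane.norm_exp_two_pi_I_lt_one τ
    have h1 := tsum_pow_div_one_sub_eq_tsum_sigma hq (2 * m - 1)
    have hc : eisensteinConst m = -(bernoulli (2 * m) : ℂ) / (2 * m) := by
      have h2 : (1 - 2 * ((m : ℤ) : ℂ)) = -((2 * m - 1 : ℕ) : ℂ) := by
        rw [Nat.cast_sub (by omega)]; push_cast; ring
      rw [eisensteinConst, if_neg (by omega), h2, riemannZeta_neg_nat_eq_bernoulli',
        show 2 * m - 1 + 1 = 2 * m by omega, bernoulli_eq_bernoulli'_of_ne_one (by omega),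
        Nat.cast_sub (by omega)]
      push_cast
      ring
    have ht : ∀ l : ℕ+, eisensteinTerm m τ l = (l : ℂ) ^ (2 * m - 1) *
        Complex.exp (2 * Real.pi * Complex.I * τ) ^ (l : ℕ) /
          (1 - Complex.exp (2 * Real.pi * Complex.I * τ) ^ (l : ℕ)) := by
      intro l
      rw [eisensteinTerm, show (2 * (m : ℤ) - 1) = ((2 * m - 1 : ℕ) : ℤ) by omega, zpow_natCast]
    rw [tsum_congr ht, h1, hc]
    simp only [zpow_natCast]
    push_cast
    rw [sub_eq_add_neg, ← neg_mul]
    congr 2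
    rw [div_div_eq_mul_div, div_neg]
  have hz0 : z ≠ 0 := by rintro rfl; simp at hz
  have hE := SlashInvariantForm.slash_S_apply (ModularForm.E hm) (2 * m : ℕ) ⟨z, hz⟩
  have hS : Matrix.SpecialLinearGroup.mapGL ℝ ModularGroup.S ∈
      (Matrix.SpecialLinearGroup.mapGL ℝ : _ →* GL (Fin 2) ℝ).range := ⟨_, rfl⟩
  have hinv := congrFun (SlashInvariantForm.slash_action_eqn (ModularForm.E hm) _ hS) ⟨z, hz⟩
  -- Invariance under `S` is compared with the explicit formula for the slash action of `S`.
  have hE := hinv.symm.trans hE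
  rw [← key, ← key] at hE
  simp only [inv_neg, zpow_neg] at hE
  rw [hE, neg_div, one_div]
  push_cast
  field_simp

theorem eisensteinConst_one : eisensteinConst 1 = -1 / 12 := by
  have h : (1 - 2 * ((1 : ℤ) : ℂ)) = -((1 : ℕ) : ℂ) := by norm_num
  rw [eisensteinConst, if_neg (by omega), h, riemannZeta_neg_nat_eq_bernoulli']
  norm_num [bernoulli'_two]

/-- The transformation law in weight `2`. -/
theorem eisensteinE_one_neg_one_div {z : ℂ} (hz : 0 < z.im) :
    eisensteinE 1 (-1 / z) = z ^ 2 * eisensteinE 1 z + 6 * z / (Real.pi * Complex.I) := by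
  have key : ∀ τ : UpperHalfPlane, eisensteinE 1 τ = EisensteinSeries.E2 τ := by
    intro τ
    rw [EisensteinSeries.E2_eq_tsum_cexp, eisensteinE]
    have hq := UpperHalfPlane.norm_exp_two_pi_I_lt_one τ
    have h1 := tsum_pow_div_one_sub_eq_tsum_sigma hq 1
    have ht : ∀ l : ℕ+, eisensteinTerm 1 τ l = (l : ℂ) ^ 1 *
        Complex.exp (2 * Real.pi * Complex.I * τ) ^ (l : ℕ) /
          (1 - Complex.exp (2 * Real.pi * Complex.I * τ) ^ (l : ℕ)) := by
      intro l
      rw [eisensteinTerm]; norm_num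
    rw [tsum_congr ht, h1, eisensteinConst_one]
    ring
  have hz0 : z ≠ 0 := by rintro rfl; simp at hz
  have hE := EisensteinSeries.G2_S_transform ⟨z, hz⟩
  rw [UpperHalfPlane.modular_S_smul] at hE
  have h1 := key ⟨z, hz⟩
  have h2 := key ⟨_, UpperHalfPlane.im_inv_neg_coe_pos ⟨z, hz⟩⟩
  simp only [EisensteinSeries.E2, Pi.smul_apply, smul_eq_mul, riemannZeta_two, inv_neg]
    at h1 h2 hE
  have hpi : (Real.pi : ℂ) ≠ 0 := by exact_mod_cast Real.pi_ne_zero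
  rw [neg_div, one_div, h1, h2, hE]
  field_simp
  linear_combination (-2 : ℂ) * z * Real.pi * Complex.I_sq

/-! ### Weight zero: integrating the weight-2 law -/

theorem norm_exp_two_pi_I_mul_lt_one {z : ℂ} (hz : 0 < z.im) :
    ‖Complex.exp (2 * Real.pi * Complex.I * z)‖ < 1 :=
  UpperHalfPlane.norm_exp_two_pi_I_lt_one ⟨z, hz⟩

theorem one_sub_exp_pow_ne_zero {z : ℂ} (hz : 0 < z.im) (l : ℕ+) :
    1 - Complex.exp (2 * Real.pi * Complex.I * z) ^ (l : ℕ) ≠ 0 := by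
  intro h
  have h1 : ‖Complex.exp (2 * Real.pi * Complex.I * z) ^ (l : ℕ)‖ < 1 := by
    rw [norm_pow]
    exact pow_lt_one₀ (norm_nonneg _) (norm_exp_two_pi_I_mul_lt_one hz) l.ne_zero
  rw [← sub_eq_zero.mp h, norm_one] at h1
  exact lt_irrefl _ h1

/-- Differentiating `q^l` brings down a factor `l`, which cancels the coefficient `l⁻¹`. -/
theorem hasDerivAt_eisensteinTerm_zero {z : ℂ} (hz : 0 < z.im) (l : ℕ+) :
    HasDerivAt (fun w => eisensteinTerm 0 w l)
      (2 * Real.pi * Complex.I * (Complex.exp (2 * Real.pi * Complex.I * z) ^ (l : ℕ) /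
        (1 - Complex.exp (2 * Real.pi * Complex.I * z) ^ (l : ℕ)) ^ 2)) z := by
  have hl : (l : ℂ) ≠ 0 := by exact_mod_cast l.ne_zero
  have hne := one_sub_exp_pow_ne_zero hz l
  have hq : HasDerivAt (fun w : ℂ => Complex.exp (2 * Real.pi * Complex.I * w) ^ (l : ℕ))
      (2 * Real.pi * Complex.I * l * Complex.exp (2 * Real.pi * Complex.I * z) ^ (l : ℕ)) z := by
    have h := (((hasDerivAt_id z).const_mul
      ((l : ℂ) * (2 * Real.pi * Complex.I)))).cexp
    simp only [id, mul_one] at h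
    have e : ∀ w : ℂ, Complex.exp (2 * Real.pi * Complex.I * w) ^ (l : ℕ) =
        Complex.exp ((l : ℂ) * (2 * Real.pi * Complex.I) * w) := by
      intro w
      rw [← Complex.exp_nat_mul, mul_assoc (l : ℂ)]
    simp only [e]
    exact h.congr_deriv (by ring)
  have h := (hq.const_mul ((l : ℂ) ^ (2 * (0 : ℤ) - 1))).div (hq.const_sub 1) hne
  refine h.congr_deriv ?_
  have e : (l : ℂ) ^ (2 * (0 : ℤ) - 1) = (l : ℂ)⁻¹ := by norm_num
  rw [e]
  field_simp
  ring

/-- The Lambert series `∑ qˡ / (1 - qˡ)²` and `∑ l qˡ / (1 - qˡ)` agree. -/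
theorem tsum_pow_div_one_sub_pow_sq {q : ℂ} (hq : ‖q‖ < 1) :
    ∑' l : ℕ+, q ^ (l : ℕ) / (1 - q ^ (l : ℕ)) ^ 2 =
      ∑' l : ℕ+, (l : ℂ) ^ 1 * q ^ (l : ℕ) / (1 - q ^ (l : ℕ)) := by
  rw [tsum_pow_div_one_sub_eq_tsum_sigma hq 1, ← tsum_prod_pow_eq_tsum_sigma 1 hq]
  refine tsum_congr fun l => ?_
  have h1 : ‖q ^ (l : ℕ)‖ < 1 := by
    rw [norm_pow]; exact pow_lt_one₀ (norm_nonneg _) hq l.ne_zero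
  -- With `x = q^l`, `x / (1 - x)²` is `∑ n xⁿ`; the term `n = 0` vanishes, so the sum may run over
  -- `ℕ+`.
  rw [← tsum_coe_mul_geometric_of_norm_lt_one h1, ← tsum_zero_pnat_eq_tsum_nat]
  · simp [pow_mul]
  · simpa using summable_pow_mul_geometric_of_norm_lt_one 1 h1

theorem hasDerivAt_tsum_eisensteinTerm_zero {z : ℂ} (hz : 0 < z.im) :
    HasDerivAt (fun w => ∑' l : ℕ+, eisensteinTerm 0 w l)
      (2 * Real.pi * Complex.I * ∑' l : ℕ+, eisensteinTerm 1 z l) z := by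
  -- On this half-plane `|q| ≤ r < 1` uniformly, so one geometric majorant justifies termwise
  -- differentiation.
  set U : Set ℂ := {w | z.im / 2 < w.im} with hU
  have hUo : IsOpen U := isOpen_lt continuous_const Complex.continuous_im
  have hzU : z ∈ U := by simp only [hU, Set.mem_ofPred_eq]; linarith
  have hpos : ∀ w ∈ U, 0 < w.im := fun w hw => by
    simp only [hU, Set.mem_ofPred_eq] at hw; linarith
  set r : ℝ := Real.exp (-(2 * Real.pi * (z.im / 2))) with hr
  have hr0 : 0 < r := Real.exp_pos _
  have hr1 : r < 1 := by
    rw [hr, Real.exp_lt_one_iff]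
    have := Real.pi_pos
    have : 0 < 2 * Real.pi * (z.im / 2) := by positivity
    linarith
  have hqr : ∀ w ∈ U, ‖Complex.exp (2 * Real.pi * Complex.I * w)‖ ≤ r := by
    intro w hw
    rw [Complex.norm_exp, hr]
    have : (2 * Real.pi * Complex.I * w).re = -(2 * Real.pi * w.im) := by
      simp [Complex.mul_re, Complex.mul_im]
    rw [this]
    simp only [hU, Set.mem_ofPred_eq] at hw
    have := Real.pi_pos
    gcongr
  have hsum : Summable fun l : ℕ+ => r ^ (l : ℕ) * (1 - r)⁻¹ :=
    ((summable_geometric_of_lt_one hr0.le hr1).comp_injective PNat.coe_injective).mul_right _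
  have hd : ∀ l : ℕ+, DifferentiableOn ℂ (fun w => eisensteinTerm 0 w l) U := fun l w hw =>
    (hasDerivAt_eisensteinTerm_zero (hpos w hw) l).differentiableAt.differentiableWithinAt
  have hb : ∀ (l : ℕ+) (w : ℂ), w ∈ U → ‖eisensteinTerm 0 w l‖ ≤ r ^ (l : ℕ) * (1 - r)⁻¹ := by
    intro l w hw
    have hq := hqr w hw
    have hl : (1 : ℝ) ≤ (l : ℕ) := by exact_mod_cast l.2
    have hden : 1 - r ≤ ‖1 - Complex.exp (2 * Real.pi * Complex.I * w) ^ (l : ℕ)‖ := by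
      have h1 := norm_sub_norm_le (1 : ℂ) (Complex.exp (2 * Real.pi * Complex.I * w) ^ (l : ℕ))
      rw [norm_one, norm_pow] at h1
      have h2 := (pow_le_pow_left₀ (norm_nonneg _) hq (l : ℕ)).trans
        (pow_le_of_le_one hr0.le hr1.le l.ne_zero)
      linarith
    have hpos' : 0 < 1 - r := by linarith
    have hle : ‖((l : ℕ) : ℂ) ^ (2 * (0 : ℤ) - 1)‖ ≤ 1 := by
      have e : ((l : ℕ) : ℂ) ^ (2 * (0 : ℤ) - 1) = ((l : ℕ) : ℂ)⁻¹ := by norm_num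
      rw [e, norm_inv, Complex.norm_natCast]
      exact inv_le_one_of_one_le₀ hl
    rw [eisensteinTerm, norm_div, norm_mul, norm_pow, div_eq_mul_inv]
    calc _ ≤ 1 * r ^ (l : ℕ) * (1 - r)⁻¹ := by gcongr
      _ = _ := by ring
  have h1 := (Complex.hasSum_deriv_of_summable_norm hsum hd hUo hb hzU).tsum_eq
  have h2 := (Complex.differentiableOn_tsum_of_summable_norm hsum hd hUo hb).differentiableAt
    (hUo.mem_nhds hzU)
  have h3 := h2.hasDerivAt
  rw [← h1] at h3
  refine h3.congr_deriv ?_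
  rw [tsum_congr fun l => (hasDerivAt_eisensteinTerm_zero hz l).deriv, tsum_mul_left,
    tsum_pow_div_one_sub_pow_sq (norm_exp_two_pi_I_mul_lt_one hz)]
  simp [eisensteinTerm]

/-- The transformation law of the logarithm of the Dedekind eta function, as a Lambert series. -/
theorem tsum_eisensteinTerm_zero_neg_one_div {z : ℂ} (hz : 0 < z.im) :
    ∑' l : ℕ+, eisensteinTerm 0 (-1 / z) l = (∑' l : ℕ+, eisensteinTerm 0 z l) -
      1 / 2 * (Complex.log z - Real.pi * Complex.I / 2 + Real.pi * Complex.I * z / 6 +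
        Real.pi * Complex.I / (6 * z)) := by
  -- `F` is the defect of the claimed identity: its derivative vanishes by the weight-2 law, and `F
  -- i = 0`.
  set F : ℂ → ℂ := fun w => (∑' l : ℕ+, eisensteinTerm 0 (-1 / w) l) -
    (∑' l : ℕ+, eisensteinTerm 0 w l) +
      1 / 2 * (Complex.log w - Real.pi * Complex.I / 2 + Real.pi * Complex.I * w / 6 +
        Real.pi * Complex.I / (6 * w)) with hF
  have hpi : (Real.pi : ℂ) ≠ 0 := by exact_mod_cast Real.pi_ne_zero
  have hder : ∀ w ∈ {w : ℂ | 0 < w.im}, HasDerivWithinAt F 0 {w : ℂ | 0 < w.im} w := by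
    intro w hw
    have hw' : 0 < w.im := hw
    have hw0 : w ≠ 0 := by rintro rfl; simp at hw'
    have hinv : HasDerivAt (fun w : ℂ => -1 / w) (1 / w ^ 2) w := by
      have h := (hasDerivAt_inv hw0).const_mul (-1)
      simp only [← div_eq_mul_inv] at h
      exact h.congr_deriv (by field_simp)
    have hS := (hasDerivAt_tsum_eisensteinTerm_zero (im_neg_one_div_pos hw')).comp w hinv
    have hlog : HasDerivAt Complex.log w⁻¹ w :=
      Complex.hasDerivAt_log (Or.inr hw'.ne')
    have hlin : HasDerivAt (fun w : ℂ => Real.pi * Complex.I * w / 6)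
        (Real.pi * Complex.I / 6) w := by
      have h := ((hasDerivAt_id w).const_mul (Real.pi * Complex.I : ℂ)).div_const 6
      simpa using h
    have hrec : HasDerivAt (fun w : ℂ => Real.pi * Complex.I / (6 * w))
        (-(Real.pi * Complex.I / 6) / w ^ 2) w := by
      have h := hinv.const_mul (-(Real.pi * Complex.I / 6) : ℂ)
      refine (h.congr_deriv (by ring)).congr_of_eventuallyEq (.of_forall fun x => ?_)
      simp only [div_eq_mul_inv, mul_inv]
      ring
    have h := (hS.sub (hasDerivAt_tsum_eisensteinTerm_zero hw')).add
      ((((hlog.sub_const (Real.pi * Complex.I / 2)).add hlin).add hrec).const_mul (1 / 2))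
    refine HasDerivAt.hasDerivWithinAt (h.congr_deriv ?_)
    have hE := eisensteinE_one_neg_one_div hw'
    rw [eisensteinE, eisensteinE, eisensteinConst_one] at hE
    have hI : Complex.I ≠ 0 := Complex.I_ne_zero
    generalize (∑' l : ℕ+, eisensteinTerm 1 (-1 / w) l) = A at hE ⊢
    generalize (∑' l : ℕ+, eisensteinTerm 1 w l) = B at hE ⊢
    have hA : A = (1 - w ^ 2 * (1 - 24 * B) - 6 * w / (Real.pi * Complex.I)) / 24 := by
      linear_combination (-1 / 24 : ℂ) * hE
    rw [hA]
    field_simp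
    ring
  have hconv : Convex ℝ {w : ℂ | 0 < w.im} := convex_halfSpace_im_gt 0
  have hconst := hconv.is_const_of_fderivWithin_eq_zero (𝕜 := ℂ) (f := F)
    (fun w hw => (hder w hw).differentiableWithinAt)
    (fun w hw => by
      have h := (hder w hw).hasFDerivWithinAt
      have hu : UniqueDiffWithinAt ℂ {w : ℂ | 0 < w.im} w :=
        (isOpen_lt continuous_const Complex.continuous_im).uniqueDiffWithinAt hw
      rw [h.fderivWithin hu]
      simp)
    (show Complex.I ∈ {w : ℂ | 0 < w.im} by simp) (show z ∈ {w : ℂ | 0 < w.im} from hz)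
  have hFI : F Complex.I = 0 := by
    have e : -1 / Complex.I = Complex.I := by
      rw [Complex.div_I]; ring
    simp only [hF, e, Complex.log_I]
    field_simp
    linear_combination (2 * Real.pi : ℂ) * Complex.I_sq
  rw [hFI] at hconst
  simp only [hF] at hconst
  linear_combination -hconst

/-- The transformation law in weight `0`. -/
theorem eisensteinE_zero_neg_one_div {z : ℂ} (hz : 0 < z.im) :
    eisensteinE 0 (-1 / z) = eisensteinE 0 z + 1 / (Real.log (2 * Real.pi) : ℂ) *
      (Complex.log z - Real.pi * Complex.I / 2 + Real.pi * Complex.I * z / 6 +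
        Real.pi * Complex.I / (6 * z)) := by
  rw [eisensteinE, eisensteinE, eisensteinConst_zero, tsum_eisensteinTerm_zero_neg_one_div hz]
  simp only [div_neg]
  ring

/-! ### Negative weight: double series and Ramanujan's formula -/

/-- The partial fraction identity behind the reciprocity of the double series. -/
theorem inv_pow_mul_sub_eq {x y t : ℂ} (hx : x ≠ 0) (hy : y ≠ 0) (hd : x * t - y ≠ 0) (p : ℕ) :
    (x ^ p * (x * t - y))⁻¹ = t ^ p * (y ^ p * (x * t - y))⁻¹ -
      ∑ i ∈ Finset.range p, t ^ i * ((x ^ (p - i))⁻¹ * (y ^ (i + 1))⁻¹) := by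
  induction p with
  | zero => simp
  | succ p ih =>
    have h1 : (x ^ (p + 1) * (x * t - y))⁻¹ = x⁻¹ * (x ^ p * (x * t - y))⁻¹ := by
      rw [pow_succ', mul_assoc, mul_inv]
    have h2 : ∀ i ∈ Finset.range p, t ^ i * ((x ^ (p + 1 - i))⁻¹ * (y ^ (i + 1))⁻¹) =
        x⁻¹ * (t ^ i * ((x ^ (p - i))⁻¹ * (y ^ (i + 1))⁻¹)) := by
      intro i hi
      rw [Nat.succ_sub (Finset.mem_range.mp hi).le, pow_succ', mul_inv]
      ring
    rw [h1, ih, Finset.sum_range_succ, Finset.sum_congr rfl h2, ← Finset.mul_sum,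
      Nat.add_sub_cancel_left, pow_one]
    have h3 : x⁻¹ * (t ^ p * (y ^ p * (x * t - y))⁻¹) =
        t ^ (p + 1) * (y ^ (p + 1) * (x * t - y))⁻¹ - t ^ p * (x⁻¹ * (y ^ (p + 1))⁻¹) := by
      field_simp
      ring
    linear_combination h3

theorem hasSum_pnat_inv_pow {n : ℕ} (hn : 1 < n) :
    HasSum (fun l : ℕ+ => ((l : ℂ) ^ n)⁻¹) (riemannZeta n) := by
  have hs : Summable fun l : ℕ => 1 / (l : ℂ) ^ n := by
    have h := Complex.summable_one_div_nat_cpow (p := n).mpr (by simpa using hn)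
    simpa using h
  have h := hs.comp_injective PNat.coe_injective
  have h2 := tsum_zero_pnat_eq_tsum_nat hs
  rw [← zeta_nat_eq_tsum_of_gt_one hn] at h2
  have h0 : (1 : ℂ) / ((0 : ℕ) : ℂ) ^ n = 0 := by simp [show n ≠ 0 by omega]
  rw [h0, zero_add] at h2
  simp only [one_div] at h2
  rw [← h2]
  simpa [Function.comp_def] using h.hasSum

theorem hasSum_pnat_prod_inv_pow {m n : ℕ} (hm : 1 < m) (hn : 1 < n) :
    HasSum (fun x : ℕ+ × ℕ+ => ((x.1 : ℂ) ^ m)⁻¹ * ((x.2 : ℂ) ^ n)⁻¹)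
      (riemannZeta m * riemannZeta n) := by
  obtain ⟨f, hf⟩ : ∃ f : ℕ+ → ℂ, f = fun l : ℕ+ => ((l : ℂ) ^ m)⁻¹ := ⟨_, rfl⟩
  obtain ⟨g, hg⟩ : ∃ g : ℕ+ → ℂ, g = fun l : ℕ+ => ((l : ℂ) ^ n)⁻¹ := ⟨_, rfl⟩
  have h1 : HasSum f (riemannZeta m) := hf ▸ hasSum_pnat_inv_pow hm
  have h2 : HasSum g (riemannZeta n) := hg ▸ hasSum_pnat_inv_pow hn
  have h3 := h1.mul h2 (summable_mul_of_summable_norm h1.summable.norm h2.summable.norm)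
  simpa only [hf, hg] using h3

/-- A lower bound for the linear form `a z + b` at a point of the upper half-plane. -/
theorem norm_mul_add_ge {z : ℂ} (hz : 0 < z.im) (a b : ℝ) :
    |b| * (z.im / ‖z‖) ≤ ‖(a : ℂ) * z + b‖ := by
  have hz0 : z ≠ 0 := by rintro rfl; simp at hz
  have hn : 0 < ‖z‖ := norm_pos_iff.mpr hz0
  rw [← mul_div_assoc, div_le_iff₀ hn]
  -- Multiplying by the conjugate of `z` makes the `a` term real, leaving imaginary part `-b *
  -- z.im`.
  have h : |(((a : ℂ) * z + b) * (starRingEnd ℂ) z).im| ≤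
      ‖((a : ℂ) * z + b) * (starRingEnd ℂ) z‖ := Complex.abs_im_le_norm _
  rw [norm_mul, RCLike.norm_conj] at h
  refine le_trans (le_of_eq ?_) h
  have e : (((a : ℂ) * z + b) * (starRingEnd ℂ) z).im = -(b * z.im) := by
    simp [Complex.mul_im]
    ring
  rw [e, abs_neg, abs_mul, abs_of_pos hz]

/-- The summand of the double series attached to a Lambert series of negative weight. -/
noncomputable def reciprocityKernel (p : ℕ) (z : ℂ) (x : ℕ+ × ℕ+) : ℂ :=
  (((x.1 : ℂ) ^ 2) ^ p * ((x.1 : ℂ) ^ 2 * z ^ 2 - (x.2 : ℂ) ^ 2))⁻¹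

theorem norm_sq_mul_sub_ge {z : ℂ} (hz : 0 < z.im) (l m : ℕ+) :
    ((m : ℕ) : ℝ) ^ 2 * (z.im / ‖z‖) ^ 2 ≤ ‖(l : ℂ) ^ 2 * z ^ 2 - (m : ℂ) ^ 2‖ := by
  have h1 := norm_mul_add_ge hz ((l : ℕ) : ℝ) ((m : ℕ) : ℝ)
  have h2 := norm_mul_add_ge hz ((l : ℕ) : ℝ) (-((m : ℕ) : ℝ))
  rw [abs_neg] at h2
  have hm : |((m : ℕ) : ℝ)| = (m : ℕ) := abs_of_nonneg (Nat.cast_nonneg _)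
  rw [hm] at h1 h2
  have e : (l : ℂ) ^ 2 * z ^ 2 - (m : ℂ) ^ 2 =
      ((((l : ℕ) : ℝ) : ℂ) * z + (((m : ℕ) : ℝ) : ℂ)) *
        ((((l : ℕ) : ℝ) : ℂ) * z + ((-((m : ℕ) : ℝ) : ℝ) : ℂ)) := by
    push_cast
    ring
  rw [e, norm_mul]
  calc _ = (((m : ℕ) : ℝ) * (z.im / ‖z‖)) * (((m : ℕ) : ℝ) * (z.im / ‖z‖)) := by ring
    _ ≤ _ := by gcongr

theorem sq_mul_sub_ne_zero {z : ℂ} (hz : 0 < z.im) (l m : ℕ+) :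
    (l : ℂ) ^ 2 * z ^ 2 - (m : ℂ) ^ 2 ≠ 0 := by
  have hz0 : z ≠ 0 := by rintro rfl; simp at hz
  have hn : 0 < ‖z‖ := norm_pos_iff.mpr hz0
  have hm : (0 : ℝ) < (m : ℕ) := by exact_mod_cast m.pos
  rw [← norm_pos_iff]
  exact lt_of_lt_of_le (by positivity) (norm_sq_mul_sub_ge hz l m)

/-- The majorant is a constant times `l^{-2p} m^{-2}`, whose sum over `l` converges because `p ≥ 1`.
Absolute convergence permits both exchanging `l` with `m` and summing by rows. -/
theorem summable_reciprocityKernel {p : ℕ} (hp : 1 ≤ p) {z : ℂ} (hz : 0 < z.im) :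
    Summable (reciprocityKernel p z) := by
  have hz0 : z ≠ 0 := by rintro rfl; simp at hz
  have hn : 0 < ‖z‖ := norm_pos_iff.mpr hz0
  have hs : ∀ n : ℕ, 1 < n → Summable fun l : ℕ+ => (((l : ℕ) : ℝ) ^ n)⁻¹ := fun n hn =>
    (Real.summable_nat_pow_inv.mpr hn).comp_injective PNat.coe_injective
  have h := ((hs (2 * p) (by omega)).mul_of_nonneg (hs 2 (by omega))
    (fun _ => by positivity) (fun _ => by positivity)).mul_right (((z.im / ‖z‖) ^ 2)⁻¹)
  refine Summable.of_norm_bounded h fun x => ?_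
  have hm : (0 : ℝ) < (x.2 : ℕ) := by exact_mod_cast x.2.pos
  have hl : (0 : ℝ) < (x.1 : ℕ) := by exact_mod_cast x.1.pos
  rw [reciprocityKernel, norm_inv, norm_mul, norm_pow, norm_pow, Complex.norm_natCast, ← pow_mul,
    mul_assoc, ← mul_inv, ← mul_inv]
  gcongr
  exact norm_sq_mul_sub_ge hz x.1 x.2

/-- Reciprocity of the double series under `z ↦ -1 / z`. -/
theorem tsum_reciprocityKernel_neg_one_div {p : ℕ} (hp : 1 ≤ p) {z : ℂ} (hz : 0 < z.im) :
    z ^ 2 * ∑' x, reciprocityKernel p z x =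
      -(z ^ (2 * p) * ∑' x, reciprocityKernel p (-1 / z) x) -
        ∑ i ∈ Finset.range p, z ^ (2 * i + 2) *
          (riemannZeta (2 * (p - i) : ℕ) * riemannZeta (2 * (i + 1) : ℕ)) := by
  have hz0 : z ≠ 0 := by rintro rfl; simp at hz
  have hw := im_neg_one_div_pos hz
  have hsum : ∀ i ∈ Finset.range p, HasSum (fun x : ℕ+ × ℕ+ => z ^ (2 * i + 2) *
      (((x.1 : ℂ) ^ (2 * (p - i)))⁻¹ * ((x.2 : ℂ) ^ (2 * (i + 1)))⁻¹))
      (z ^ (2 * i + 2) * (riemannZeta (2 * (p - i) : ℕ) * riemannZeta (2 * (i + 1) : ℕ))) := by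
    intro i hi
    have hi' := Finset.mem_range.mp hi
    exact (hasSum_pnat_prod_inv_pow (by omega) (by omega)).mul_left _
  have hK := (summable_reciprocityKernel hp hw).hasSum
  have hK' := (Equiv.prodComm ℕ+ ℕ+).hasSum_iff.mpr hK
  have htot := ((hK'.mul_left (z ^ (2 * p))).neg).sub (hasSum_sum hsum)
  rw [← tsum_mul_left]
  refine (tsum_congr fun x => ?_).trans htot.tsum_eq
  obtain ⟨l, m⟩ := x
  have hl : (l : ℂ) ≠ 0 := by exact_mod_cast l.ne_zero
  have hm : (m : ℂ) ≠ 0 := by exact_mod_cast m.ne_zero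
  have hd := sq_mul_sub_ne_zero hz l m
  -- Under `z ↦ -1/z` with `l` and `m` exchanged, the quadratic form is divided by `-z²`.
  have key : z ^ 2 * (((m : ℂ) ^ 2) ^ p * ((l : ℂ) ^ 2 * z ^ 2 - (m : ℂ) ^ 2))⁻¹ =
      -(((m : ℂ) ^ 2) ^ p * ((m : ℂ) ^ 2 * (-1 / z) ^ 2 - (l : ℂ) ^ 2))⁻¹ := by
    have e : (m : ℂ) ^ 2 * (-1 / z) ^ 2 - (l : ℂ) ^ 2 =
        -(((l : ℂ) ^ 2 * z ^ 2 - (m : ℂ) ^ 2) / z ^ 2) := by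
      field_simp
      ring
    rw [e]
    field_simp
  simp only [reciprocityKernel, Function.comp_apply, Equiv.prodComm_apply, Prod.swap_prod_mk]
  rw [inv_pow_mul_sub_eq (pow_ne_zero 2 hl) (pow_ne_zero 2 hm) hd p, mul_sub, Finset.mul_sum]
  congr 1
  · rw [← pow_mul]
    linear_combination z ^ (2 * p) * key
  · refine Finset.sum_congr rfl fun i _ => ?_
    simp only [← pow_mul]
    ring

/-- Both sides are `π cot πw`: its expression in `e^{2πiw}` and its partial fraction expansion. -/
theorem pi_mul_I_mul_eq_tsum {w : ℂ} (hw : 0 < w.im) :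
    -(Real.pi * Complex.I) * (1 + 2 * (Complex.exp (2 * Real.pi * Complex.I * w) /
      (1 - Complex.exp (2 * Real.pi * Complex.I * w)))) =
      1 / w + ∑' m : ℕ+, (1 / (w - m) + 1 / (w + m)) := by
  have hc : w ∈ Complex.integerComplement :=
    UpperHalfPlane.coe_mem_integerComplement ⟨w, hw⟩
  rw [← cot_series_rep hc, Complex.cot_pi_eq_exp_ratio]
  have hq : 1 - Complex.exp (2 * Real.pi * Complex.I * w) ≠ 0 := by
    intro h
    have h1 := UpperHalfPlane.norm_exp_two_pi_I_lt_one ⟨w, hw⟩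
    simp only [← sub_eq_zero.mp h, norm_one] at h1
    exact lt_irrefl _ h1
  have hI := Complex.I_ne_zero
  generalize Complex.exp (2 * Real.pi * Complex.I * w) = q at hq ⊢
  field_simp
  linear_combination (-1 - q) * Complex.I_sq

theorem eisensteinConst_neg {p : ℕ} (hp : 1 ≤ p) :
    eisensteinConst (-p) = riemannZeta (2 * p + 1 : ℕ) := by
  rw [eisensteinConst, if_neg (by omega)]
  congr 1
  push_cast
  ring

/-- The Lambert series of weight `-2p` as a double series. -/
theorem eisensteinE_neg_eq_tsum {p : ℕ} (hp : 1 ≤ p) {z : ℂ} (hz : 0 < z.im) :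
    -(Real.pi * Complex.I) * (riemannZeta (2 * p + 1 : ℕ) * eisensteinE (-p) z) =
      z⁻¹ * riemannZeta (2 * (p + 1) : ℕ) + 2 * z * ∑' x, reciprocityKernel p z x := by
  have hz0 : z ≠ 0 := by rintro rfl; simp at hz
  have ha : riemannZeta (2 * p + 1 : ℕ) ≠ 0 :=
    riemannZeta_ne_zero_of_one_lt_re (by rw [Complex.natCast_re]; exact_mod_cast by omega)
  have hc := eisensteinConst_neg hp
  have h1 := hasSum_pnat_inv_pow (n := 2 * p + 1) (by omega)
  have h2 := (summable_eisensteinTerm (-p) hz).hasSum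
  have h3 := hasSum_pnat_inv_pow (n := 2 * (p + 1)) (by omega)
  have hK := summable_reciprocityKernel hp hz
  -- Both sides become sums over `l`, compared term by term using the cotangent expansion at `l z`.
  have h4 := hK.hasSum.prod_fiberwise (fun l => (hK.prod_factor l).hasSum)
  have hL := (h1.add (h2.mul_left 2)).mul_left (-(Real.pi * Complex.I))
  have hR := (h3.mul_left z⁻¹).add (h4.mul_left (2 * z))
  have hE : riemannZeta (2 * p + 1 : ℕ) * eisensteinE (-p) z =
      riemannZeta (2 * p + 1 : ℕ) + 2 * ∑' l : ℕ+, eisensteinTerm (-p) z l := by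
    rw [eisensteinE, hc]
    field_simp
  rw [hE]
  refine hL.unique ?_
  convert hR using 2 with l
  have hl : (l : ℂ) ≠ 0 := by exact_mod_cast l.ne_zero
  have hlz : 0 < ((l : ℂ) * z).im := by
    have : (0 : ℝ) < (l : ℕ) := by exact_mod_cast l.pos
    simpa using hz
  have hcot := pi_mul_I_mul_eq_tsum hlz
  have hq : Complex.exp (2 * Real.pi * Complex.I * (l * z)) =
      Complex.exp (2 * Real.pi * Complex.I * z) ^ (l : ℕ) := by
    rw [← Complex.exp_nat_mul]
    ring_nf
  rw [hq] at hcot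
  have hterm : eisensteinTerm (-p) z l = ((l : ℂ) ^ (2 * p + 1))⁻¹ *
      (Complex.exp (2 * Real.pi * Complex.I * z) ^ (l : ℕ) /
        (1 - Complex.exp (2 * Real.pi * Complex.I * z) ^ (l : ℕ))) := by
    rw [eisensteinTerm, show 2 * (-(p : ℤ)) - 1 = -((2 * p + 1 : ℕ) : ℤ) by push_cast; ring,
      zpow_neg, zpow_natCast, mul_div_assoc]
  have hker : ∀ m : ℕ+, 2 * z * reciprocityKernel p z (l, m) = ((l : ℂ) ^ (2 * p + 1))⁻¹ *
      (1 / ((l : ℂ) * z - m) + 1 / ((l : ℂ) * z + m)) := by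
    intro m
    have hd := sq_mul_sub_ne_zero hz l m
    have e : (l : ℂ) ^ 2 * z ^ 2 - (m : ℂ) ^ 2 = ((l : ℂ) * z - m) * ((l : ℂ) * z + m) := by ring
    rw [e] at hd
    have hd1 := left_ne_zero_of_mul hd
    have hd2 := right_ne_zero_of_mul hd
    rw [reciprocityKernel, e, ← pow_mul, one_div_add_one_div hd1 hd2,
      show (l : ℂ) * z - m + (l * z + m) = 2 * (l * z) by ring]
    generalize (l : ℂ) * z - m = u at *
    generalize (l : ℂ) * z + m = v at *
    field_simp
    ring
  rw [hterm, ← tsum_mul_left, tsum_congr hker, tsum_mul_left]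
  have hlast : z⁻¹ * ((l : ℂ) ^ (2 * (p + 1)))⁻¹ =
      ((l : ℂ) ^ (2 * p + 1))⁻¹ * (1 / ((l : ℂ) * z)) := by
    field_simp
    ring
  rw [hlast, ← mul_add, ← hcot]
  ring

/-- Euler's evaluation of `ζ(2n)`, including the value at `n = 0`. -/
theorem riemannZeta_two_mul_eq (n : ℕ) :
    riemannZeta (2 * n : ℕ) = -(2 * Real.pi * Complex.I) ^ (2 * n) / 2 *
      (bernoulli (2 * n) / (2 * n).factorial) := by
  push_cast
  have h : (2 : ℂ) ^ (2 * (n : ℤ)) = 2 ^ (2 * n) := by exact_mod_cast zpow_natCast (2 : ℂ) (2 * n)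
  rw [riemannZeta_two_mul_nat', zpow_sub₀ two_ne_zero, h, mul_pow, pow_mul Complex.I,
    Complex.I_sq, mul_pow, zpow_one]
  ring

/-- Ramanujan's formula: the transformation law in negative weight. -/
theorem eisensteinE_neg_neg_one_div {p : ℕ} (hp : 1 ≤ p) {z : ℂ} (hz : 0 < z.im) :
    z ^ (2 * p) * eisensteinE (-p) (-1 / z) = eisensteinE (-p) z +
      (-2 * Real.pi * Complex.I) ^ (2 * p + 1) / riemannZeta (2 * p + 1 : ℕ) *
        ∑ j ∈ Finset.range (p + 2), (bernoulli (2 * j) : ℂ) * bernoulli (2 * (p + 1 - j)) /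
          ((2 * j).factorial * (2 * (p + 1 - j)).factorial) * z ^ (2 * p + 1 - 2 * j : ℤ) := by
  have hz0 : z ≠ 0 := by rintro rfl; simp at hz
  have hpi : (Real.pi : ℂ) ≠ 0 := by exact_mod_cast Real.pi_ne_zero
  have hI := Complex.I_ne_zero
  have ha : riemannZeta (2 * p + 1 : ℕ) ≠ 0 :=
    riemannZeta_ne_zero_of_one_lt_re (by rw [Complex.natCast_re]; exact_mod_cast by omega)
  have hz1 := eisensteinE_neg_eq_tsum hp hz
  have hw1 := eisensteinE_neg_eq_tsum hp (im_neg_one_div_pos hz)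
  have hrec := tsum_reciprocityKernel_neg_one_div hp hz
  -- Two uses of Euler's formula, each with a factor `-(2πi)^{2n} / 2`, produce the constant `4 /
  -- (2πi)^{2p+2}`.
  have hbern : ∀ j ∈ Finset.range (p + 2), (bernoulli (2 * j) : ℂ) * bernoulli (2 * (p + 1 - j)) /
      ((2 * j).factorial * (2 * (p + 1 - j)).factorial) * z ^ (2 * p + 1 - 2 * j : ℤ) =
      4 / (2 * Real.pi * Complex.I) ^ (2 * p + 2) * (z⁻¹ *
        (z ^ (2 * (p + 1 - j)) *
          (riemannZeta (2 * j : ℕ) * riemannZeta (2 * (p + 1 - j) : ℕ)))) := by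
    intro j hj
    have hj' : j ≤ p + 1 := by have := Finset.mem_range.mp hj; omega
    obtain ⟨i, hi⟩ := Nat.exists_eq_add_of_le hj'
    have e1 : p + 1 - j = i := by omega
    have e2 : (2 * p + 1 - 2 * j : ℤ) = (2 * i : ℕ) - 1 := by
      have : (p : ℤ) + 1 = j + i := by exact_mod_cast hi
      push_cast
      linarith
    have e3 : 2 * p + 2 = 2 * j + 2 * i := by omega
    rw [e1, e2, e3, zpow_sub_one₀ hz0, zpow_natCast, riemannZeta_two_mul_eq,
      riemannZeta_two_mul_eq, pow_add]
    have h1 : (2 * Real.pi * Complex.I) ^ (2 * j) ≠ 0 := by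
      exact pow_ne_zero _ (by simp [hpi])
    have h2 : (2 * Real.pi * Complex.I) ^ (2 * i) ≠ 0 := by
      exact pow_ne_zero _ (by simp [hpi])
    field_simp
    ring
  -- The end terms `j = 0` and `j = p + 1` contain `ζ(0) = -1/2` and account for the `ζ(2p+2)`
  -- terms; the middle terms, reversed, are the sum in the reciprocity law.
  rw [Finset.sum_congr rfl hbern, ← Finset.mul_sum, ← Finset.mul_sum, Finset.sum_range_succ,
    Finset.sum_range_succ', ← Finset.sum_range_reflect]
  have hmid : ∀ i ∈ Finset.range p, z ^ (2 * (p + 1 - (p - 1 - i + 1))) *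
      (riemannZeta (2 * (p - 1 - i + 1) : ℕ) * riemannZeta (2 * (p + 1 - (p - 1 - i + 1)) : ℕ)) =
      z ^ (2 * i + 2) * (riemannZeta (2 * (p - i) : ℕ) * riemannZeta (2 * (i + 1) : ℕ)) := by
    intro i hi
    have hi' := Finset.mem_range.mp hi
    rw [show p - 1 - i + 1 = p - i by omega, show p + 1 - (p - i) = i + 1 by omega,
      show 2 * (i + 1) = 2 * i + 2 by ring]
  rw [Finset.sum_congr rfl hmid]
  generalize (∑ i ∈ Finset.range p, z ^ (2 * i + 2) *
    (riemannZeta (2 * (p - i) : ℕ) * riemannZeta (2 * (i + 1) : ℕ))) = Q at hrec ⊢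
  generalize (∑' x, reciprocityKernel p z x) = K at hrec hz1
  generalize (∑' x, reciprocityKernel p (-1 / z) x) = K' at hrec hw1
  generalize eisensteinE (-p) z = A at hz1 ⊢
  generalize eisensteinE (-p) (-1 / z) = A' at hw1 ⊢
  simp only [mul_zero, Nat.cast_zero, riemannZeta_zero, Nat.sub_self, Nat.sub_zero, pow_zero]
  generalize riemannZeta (2 * p + 1 : ℕ) = a at *
  generalize riemannZeta (2 * (p + 1) : ℕ) = b at *
  have hcoef : (-2 * Real.pi * Complex.I) ^ (2 * p + 1) / a *
      (4 / (2 * Real.pi * Complex.I) ^ (2 * p + 2) * (z⁻¹ * (Q + z ^ (2 * (p + 1)) *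
        (-1 / 2 * b) + 1 * (b * (-1 / 2))))) =
      -2 / (Real.pi * Complex.I * a) * (z⁻¹ * (Q - z ^ (2 * (p + 1)) * b / 2 - b / 2)) := by
    rw [show -2 * Real.pi * Complex.I = -(2 * Real.pi * Complex.I) by ring,
      Odd.neg_pow ⟨p, rfl⟩, pow_succ _ (2 * p + 1)]
    field_simp
    ring
  rw [hcoef]
  have hz1' : A = -(z⁻¹ * b + 2 * z * K) / (Real.pi * Complex.I * a) := by
    rw [← hz1]; field_simp
  have hw1' : A' = -((-1 / z)⁻¹ * b + 2 * (-1 / z) * K') / (Real.pi * Complex.I * a) := by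
    rw [← hw1]; field_simp
  rw [hz1', hw1']
  field_simp
  linear_combination 2 * hrec

/-! ### All weights together -/

theorem corollary4p6 :
    (∀ (k : ℤ) (z : ℂ), 0 < z.im →
      eisensteinE k (-1 / z) =
        z ^ (2 * k) *
          (eisensteinE k z +
            (-2 * Real.pi * Complex.I) ^ (1 - 2 * k) / eisensteinConst k *
              ((Complex.log z / (2 * Real.pi * Complex.I) - 1 / 4) * (if k = 0 then 1 else 0) +
                ∑ j ∈ Finset.Icc (0 : ℤ) (1 - k),
                  (bernoulli (2 * j).toNat : ℂ) * (bernoulli (2 - 2 * k - 2 * j).toNat : ℂ) /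
                    ((Nat.factorial (2 * j).toNat : ℂ) *
                      (Nat.factorial (2 - 2 * k - 2 * j).toNat : ℂ)) *
                    z ^ (1 - 2 * k - 2 * j)))) ∧
    (∀ z : ℂ, 0 < z.im →
      eisensteinE 0 (-1 / z) =
        eisensteinE 0 z +
          1 / (Real.log (2 * Real.pi) : ℂ) *
            (Complex.log z - Real.pi * Complex.I / 2 + Real.pi * Complex.I * z / 6 +
              Real.pi * Complex.I / (6 * z))) ∧
    (∀ z : ℂ, 0 < z.im →
      eisensteinE 1 (-1 / z) = z ^ 2 * eisensteinE 1 z + 6 * z / (Real.pi * Complex.I)) := by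
  refine ⟨fun k z hz => ?_, fun z hz => eisensteinE_zero_neg_one_div hz,
    fun z hz => eisensteinE_one_neg_one_div hz⟩
  have hz0 : z ≠ 0 := by rintro rfl; simp at hz
  have hpi : (Real.pi : ℂ) ≠ 0 := by exact_mod_cast Real.pi_ne_zero
  have hI := Complex.I_ne_zero
  rcases lt_or_ge 1 k with hk | hk
  · rw [if_neg (by omega), Finset.Icc_eq_empty (by omega),
      eisensteinE_neg_one_div_of_two_le (by omega) hz]
    simp
  obtain ⟨n, hn⟩ : ∃ n : ℕ, 1 - k = n := ⟨(1 - k).toNat, by omega⟩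
  have hk' : k = 1 - n := by omega
  have hsum : ∑ j ∈ Finset.Icc (0 : ℤ) (1 - k),
      (bernoulli (2 * j).toNat : ℂ) * (bernoulli (2 - 2 * k - 2 * j).toNat : ℂ) /
        ((Nat.factorial (2 * j).toNat : ℂ) * (Nat.factorial (2 - 2 * k - 2 * j).toNat : ℂ)) *
          z ^ (1 - 2 * k - 2 * j) =
      ∑ j ∈ Finset.range (n + 1), (bernoulli (2 * j) : ℂ) * bernoulli (2 * (n - j)) /
        ((2 * j).factorial * (2 * (n - j)).factorial) * z ^ (2 * n - 1 - 2 * j : ℤ) := by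
    symm
    refine Finset.sum_bij (fun j _ => (j : ℤ)) ?_ ?_ ?_ ?_
    · intro j hj
      have := Finset.mem_range.mp hj
      rw [Finset.mem_Icc]
      omega
    · intro i _ j _ h
      exact_mod_cast h
    · intro j hj
      rw [Finset.mem_Icc] at hj
      exact ⟨j.toNat, Finset.mem_range.mpr (by omega), by omega⟩
    · intro j hj
      have := Finset.mem_range.mp hj
      rw [show (2 * (j : ℤ)).toNat = 2 * j by omega,
        show (2 - 2 * k - 2 * (j : ℤ)).toNat = 2 * (n - j) by omega,
        show 1 - 2 * k - 2 * (j : ℤ) = 2 * n - 1 - 2 * j by omega]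
  rw [hsum]
  rcases eq_or_ne k 1 with rfl | h1
  -- Only `j = 0` remains, contributing `z⁻¹`.
  · obtain rfl : n = 0 := by omega
    rw [eisensteinE_one_neg_one_div hz, eisensteinConst_one]
    norm_num [zpow_neg]
    field_simp
    linear_combination (12 : ℂ) * Complex.I_sq
  rcases eq_or_ne k 0 with rfl | h0
  · obtain rfl : n = 1 := by omega
    have hlog : (Real.log (2 * Real.pi) : ℂ) ≠ 0 := by
      have : 0 < Real.log (2 * Real.pi) := Real.log_pos (by linarith [Real.pi_gt_three])
      exact_mod_cast this.ne'
    rw [eisensteinE_zero_neg_one_div hz, eisensteinConst_zero]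
    norm_num [Finset.sum_range_succ, bernoulli_two, zpow_neg]
    field_simp
    ring
  obtain ⟨p, rfl⟩ : ∃ p : ℕ, n = p + 1 := ⟨n - 1, by omega⟩
  obtain rfl : k = -p := by push_cast at hk'; omega
  have hp : 1 ≤ p := by omega
  have hR := eisensteinE_neg_neg_one_div hp hz
  -- The factor `z^{2k} = z^{-2p}` moves to the left-hand side to match Ramanujan's formula.
  rw [if_neg h0, mul_zero, zero_add, eisensteinConst_neg hp,
    show 2 * (-(p : ℤ)) = -((2 * p : ℕ) : ℤ) by push_cast; ring, zpow_neg, zpow_natCast,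
    eq_inv_mul_iff_mul_eq₀ (pow_ne_zero _ hz0), hR,
    show 1 - -((2 * p : ℕ) : ℤ) = ((2 * p + 1 : ℕ) : ℤ) by push_cast; ring, zpow_natCast]
  congr 3
  ext j
  congr 2
  push_cast
  ring
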